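/- Let $\mathcal S\subseteq\mathbb R^d$ be a Borel set of finite Lebesgue measure, $\mathcal A=\mathbb R^m$, $\gamma\in[0,1)$, and consider the Markov decision process with transition density $T(s'\mid s,a)$ (with respect to Lebesgue measure on $\mathcal S$), reward $R(s,a)$ and initial density $T_0$. For a (stochastic or deterministic) policy $\pi$ let $V^\pi(s)=\mathbb E_\pi[\sum_{t\ge0}\gamma^tR(S_t,A_t)\mid S_0=s]$, $Q^\pi(s,a)=\mathbb E_\pi[\sum_{t\ge0}\gamma^tR(S_t,A_t)\mid S_0=s,A_0=a]$ and $A^\pi=Q^\pi-V^\pi$. Let $\mu_\theta:\mathcal S\to\mathbb R^m$, $\theta\in\mathbb R^n$, be a parametrized deterministic policy, with $m\times n$ Jacobian $\nabla_\theta\mu_\theta(s)$, and for $\sigma>0$ let $\pi_{\theta,\sigma}(\cdot\mid s)=\mathcal N(\mu_\theta(s),\sigma^2I)$. Assume that $T,T_0,R,\mu,\nabla_aT,\nabla_aR,\nabla_\theta\mu$ exist, are continuous in all variables, and are bounded. Put $$\Delta_{\mathrm{DPG}}(s,\mu_\theta)=\nabla_aA^{\mu_\theta}(s,a)\big|_{a=\mu_\theta(s)}\,\nabla_\theta\mu_\theta(s)\in\mathbb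 R^n,$$ $$\Delta_{\mathrm{CAC}}^{\sigma}(s,\mu_\theta)=\int_{\mathcal A}\pi_{\theta,\sigma}(a\mid s)\,A^{\pi_{\theta,\sigma}}(s,a)\,H\big(A^{\pi_{\theta,\sigma}}(s,a)\big)\,\big(\mu_\theta(s)-a\big)\nabla_\theta\mu_\theta(s)\,da\in\mathbb R^n,$$ where $H$ is the Heaviside function ($H(x)=1$ for $x>0$ and $H(x)=0$ otherwise). The CAC algorithm descends along $\Delta^\sigma_{\mathrm{CAC}}$; the corresponding ascent direction, normalized as the stochastic policy gradient is, is $-\sigma^{-2}\Delta^\sigma_{\mathrm{CAC}}$. Then for every state $s\in\mathcal S$ and every $\theta\in\mathbb R^n$: the function $a\mapsto A^{\mu_\theta}(s,a)$ is differentiable at $a=\mu_\theta(s)$, the integral defining $\Delta^\sigma_{\mathrm{CAC}}(s,\mu_\theta)$ converges absolutely for every $\sigma>0$, and there is a vector $g^+\in(0,1]^n$ such that $$\lim_{\sigma\to0^+}\,-\frac1{\sigma^2}\,\Delta^\sigma_{\mathrm{CAC}}(s,\mu_\theta)=g^+\circ\Delta_{\mathrm{DPG}}(s,\mu_\theta),$$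 where $\circ$ is the componentwise (Hadamard) product. In particular each coordinate of the limit has the same sign as that coordinate of $\Delta_{\mathrm{DPG}}(s,\mu_\theta)$, and at most its magnitude. -/

import Mathlib

open MeasureTheory ProbabilityTheory Filter Topology

noncomputable section

/-- The reference measure `ds` on a subset `S` of `ℝ^d`: Lebesgue measure on `S`. -/
def stateVolume {d : ℕ} (S : Set (EuclideanSpace ℝ (Fin d))) : Measure S :=
  Measure.comap (Subtype.val : S → EuclideanSpace ℝ (Fin d)) volume

/-- A continuous (discounted) Markov decision process with state space a Borel set `S ⊆ ℝ^d`
and action space `ℝ^m`. The transition function and the initial distribution are given by their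
densities with respect to Lebesgue measure on `S`: `T s a s'` is the density at `s'` of the next
state when action `a` is played in state `s`. -/
structure MDP (d m : ℕ) where
  S : Set (EuclideanSpace ℝ (Fin d))
  measurableSet_S : MeasurableSet S
  T : S → EuclideanSpace ℝ (Fin m) → S → ℝ
  T_nonneg : ∀ s a s', 0 ≤ T s a s'
  measurable_T : Measurable fun x : (S × EuclideanSpace ℝ (Fin m)) × S => T x.1.1 x.1.2 x.2
  lintegral_T : ∀ s a, ∫⁻ s', ENNReal.ofReal (T s a s') ∂(stateVolume S) = 1
  R : S → EuclideanSpace ℝ (Fin m) → ℝ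
  measurable_R : Measurable fun x : S × EuclideanSpace ℝ (Fin m) => R x.1 x.2
  T₀ : S → ℝ
  T₀_nonneg : ∀ s, 0 ≤ T₀ s
  measurable_T₀ : Measurable T₀
  lintegral_T₀ : ∫⁻ s, ENNReal.ofReal (T₀ s) ∂(stateVolume S) = 1
  γ : ℝ
  γ_nonneg : 0 ≤ γ
  γ_lt_one : γ < 1

namespace MDP

variable {d m n : ℕ} (M : MDP d m)

instance sigmaFinite_stateVolume : SigmaFinite (stateVolume M.S) := by
  refine SigmaFinite.of_map _ (f := Subtype.val) measurable_subtype_coe.aemeasurable ?_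
  rw [stateVolume, map_comap_subtype_coe M.measurableSet_S]
  infer_instance

/-- The transition kernel `T(· | s, a)`. -/
def transition : Kernel (M.S × EuclideanSpace ℝ (Fin m)) M.S :=
  Kernel.withDensity (Kernel.const _ (stateVolume M.S))
    fun x s' => ENNReal.ofReal (M.T x.1 x.2 s')

instance isMarkovKernel_transition : IsMarkovKernel M.transition where
  isProbabilityMeasure x := by
    refine ⟨?_⟩
    have h : Measurable (Function.uncurry
        fun (x : M.S × EuclideanSpace ℝ (Fin m)) (s' : M.S) =>
          ENNReal.ofReal (M.T x.1 x.2 s')) := M.measurable_T.ennreal_ofReal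
    rw [transition, Kernel.withDensity_apply' _ h]
    simpa using M.lintegral_T x.1 x.2

section Policy

/-! A stochastic policy is a Markov kernel `π` from states to actions. -/

variable (π : Kernel M.S (EuclideanSpace ℝ (Fin m))) [IsMarkovKernel π]

/-- One step of the state-action chain: from `(s, a)` draw `s' ∼ T(· | s, a)`,
then `a' ∼ π(· | s')`. -/
def step : Kernel (M.S × EuclideanSpace ℝ (Fin m)) (M.S × EuclideanSpace ℝ (Fin m)) :=
  M.transition.compProd (Kernel.prodMkLeft _ π)

instance isMarkovKernel_step : IsMarkovKernel (M.step π) := by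
  unfold step; infer_instance

/-- The same step, as a kernel from the history up to time `t`. -/
def historyStep (t : ℕ) :
    Kernel ((_ : Finset.Iic t) → M.S × EuclideanSpace ℝ (Fin m))
      (M.S × EuclideanSpace ℝ (Fin m)) :=
  (M.step π).comap (fun h => h ⟨t, Finset.mem_Iic.2 le_rfl⟩) (measurable_pi_apply _)

instance isMarkovKernel_historyStep (t : ℕ) : IsMarkovKernel (M.historyStep π t) := by
  unfold historyStep; infer_instance

/-- The law of the trajectory `((S_t, A_t))_t` when `(S_0, A_0) ∼ ρ` and policy `π` is
followed afterwards. -/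
def law (ρ : Measure (M.S × EuclideanSpace ℝ (Fin m))) [IsProbabilityMeasure ρ] :
    Measure (ℕ → M.S × EuclideanSpace ℝ (Fin m)) :=
  Kernel.trajMeasure (X := fun _ => M.S × EuclideanSpace ℝ (Fin m)) ρ (M.historyStep π)

/-- The discounted return `∑ γ^t R(S_t, A_t)` of a trajectory. -/
def discountedReturn (ω : ℕ → M.S × EuclideanSpace ℝ (Fin m)) : ℝ :=
  ∑' t : ℕ, M.γ ^ t * M.R (ω t).1 (ω t).2

/-- `V^π(s)`: expected return given `S_0 = s`. -/
def V (s : M.S) : ℝ :=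
  ∫ ω, M.discountedReturn ω ∂(M.law π ((Measure.dirac s).prod (π s)))

/-- `Q^π(s, a)`: expected return given `S_0 = s`, `A_0 = a`. -/
def Q (s : M.S) (a : EuclideanSpace ℝ (Fin m)) : ℝ :=
  ∫ ω, M.discountedReturn ω ∂(M.law π (Measure.dirac (s, a)))

/-- The advantage function `A^π(s, a) = Q^π(s, a) - V^π(s)`. -/
def advantage (s : M.S) (a : EuclideanSpace ℝ (Fin m)) : ℝ :=
  M.Q π s a - M.V π s

end Policy

/-- The regularity conditions on the process: `T, T₀, R, ∇_a T, ∇_a R` exist, are continuous in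
all variables and bounded. -/
structure Regular : Prop where
  continuous_T : Continuous fun x : M.S × EuclideanSpace ℝ (Fin m) × M.S => M.T x.1 x.2.1 x.2.2
  bounded_T : ∃ C, ∀ s a s', |M.T s a s'| ≤ C
  differentiable_T : ∀ s s', Differentiable ℝ fun a => M.T s a s'
  continuous_grad_T : Continuous fun x : M.S × EuclideanSpace ℝ (Fin m) × M.S =>
    gradient (fun a => M.T x.1 a x.2.2) x.2.1
  bounded_grad_T : ∃ C, ∀ s a s', ‖gradient (fun a => M.T s a s') a‖ ≤ C
  continuous_R : Continuous fun x : M.S × EuclideanSpace ℝ (Fin m) => M.R x.1 x.2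
  bounded_R : ∃ C, ∀ s a, |M.R s a| ≤ C
  differentiable_R : ∀ s, Differentiable ℝ (M.R s)
  continuous_grad_R : Continuous fun x : M.S × EuclideanSpace ℝ (Fin m) =>
    gradient (M.R x.1) x.2
  bounded_grad_R : ∃ C, ∀ s a, ‖gradient (M.R s) a‖ ≤ C
  continuous_T₀ : Continuous M.T₀
  bounded_T₀ : ∃ C, ∀ s, |M.T₀ s| ≤ C

/-- A parametrized deterministic policy `μ_θ`, `θ ∈ ℝ^n`, with each `μ_θ` measurable. -/
structure ParamPolicy (n : ℕ) where
  act : EuclideanSpace ℝ (Fin n) → M.S → EuclideanSpace ℝ (Fin m)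
  measurable_act : ∀ θ, Measurable (act θ)

namespace ParamPolicy

variable {M} (μ : M.ParamPolicy n)

/-- The regularity conditions on the policy: `μ, ∇_θ μ` exist, are continuous in all variables
and bounded. -/
structure Regular : Prop where
  continuous_act : Continuous fun x : EuclideanSpace ℝ (Fin n) × M.S => μ.act x.1 x.2
  bounded_act : ∃ C, ∀ θ s, ‖μ.act θ s‖ ≤ C
  differentiable_act : ∀ s, Differentiable ℝ fun θ => μ.act θ s
  continuous_fderiv_act : Continuous fun x : EuclideanSpace ℝ (Fin n) × M.S =>
    fderiv ℝ (fun θ => μ.act θ x.2) x.1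
  bounded_fderiv_act : ∃ C, ∀ θ s, ‖fderiv ℝ (fun θ => μ.act θ s) θ‖ ≤ C

/-- `μ_θ` seen as a (degenerate) stochastic policy. -/
def det (θ : EuclideanSpace ℝ (Fin n)) : Kernel M.S (EuclideanSpace ℝ (Fin m)) :=
  Kernel.deterministic (μ.act θ) (μ.measurable_act θ)

instance isMarkovKernel_det (θ : EuclideanSpace ℝ (Fin n)) : IsMarkovKernel (μ.det θ) := by
  unfold det; infer_instance

/-- The Gaussian exploration policy `π_{θ,σ}(· | s) = N(μ_θ(s), σ² I)`. -/
def gaussian (θ : EuclideanSpace ℝ (Fin n)) (σ : ℝ) : Kernel M.S (EuclideanSpace ℝ (Fin m)) where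
  toFun s := multivariateGaussian (μ.act θ s) (σ ^ 2 • (1 : Matrix (Fin m) (Fin m) ℝ))
  measurable' := by
    refine Measure.measurable_of_measurable_coe _ fun B hB => ?_
    have h := μ.measurable_act θ
    have key (L : EuclideanSpace ℝ (Fin m) →L[ℝ] EuclideanSpace ℝ (Fin m)) :
        Measurable fun s => (stdGaussian (EuclideanSpace ℝ (Fin m))).map
          (fun x => μ.act θ s + L x) B := by
      have hf : Measurable fun p : M.S × EuclideanSpace ℝ (Fin m) => μ.act θ p.1 + L p.2 := by
        fun_prop
      convert measurable_measure_prodMk_left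
        (ν := stdGaussian (EuclideanSpace ℝ (Fin m))) (hf hB) using 2 with s
      exact Measure.map_apply (by fun_prop) hB
    exact key _

instance isMarkovKernel_gaussian (θ : EuclideanSpace ℝ (Fin n)) (σ : ℝ) :
    IsMarkovKernel (μ.gaussian θ σ) where
  isProbabilityMeasure s := by
    change IsProbabilityMeasure (multivariateGaussian _ _)
    infer_instance

/-- The Jacobian matrix `∇_θ μ_θ(s)`, with entries `∂ (μ_θ(s))_i / ∂ θ_k`. -/
def jacobian (θ : EuclideanSpace ℝ (Fin n)) (s : M.S) : Matrix (Fin m) (Fin n) ℝ :=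
  Matrix.of fun i k => fderiv ℝ (fun ϑ => μ.act ϑ s) θ (EuclideanSpace.single k 1) i

end ParamPolicy

/-- The Heaviside function. -/
def heaviside (x : ℝ) : ℝ := if 0 < x then 1 else 0

variable {M} in
/-- The DPG direction `Δ_DPG(s, μ_θ) = ∇_a A^μ(s, a)|_{a = μ_θ(s)} ∇_θ μ_θ(s)`. -/
def ParamPolicy.dpg (μ : M.ParamPolicy n) (θ : EuclideanSpace ℝ (Fin n)) (s : M.S) :
    Fin n → ℝ :=
  Matrix.vecMul (gradient (M.advantage (μ.det θ) s) (μ.act θ s)).ofLp (μ.jacobian θ s)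

variable {M} in
/-- The integrand `A^π(s, a) H(A^π(s, a)) (μ_θ(s) - a) ∇_θ μ_θ(s)` of the CAC direction,
where `π = π_{θ,σ}`. -/
def ParamPolicy.cacIntegrand (μ : M.ParamPolicy n) (θ : EuclideanSpace ℝ (Fin n)) (σ : ℝ)
    (s : M.S) (a : EuclideanSpace ℝ (Fin m)) : Fin n → ℝ :=
  (M.advantage (μ.gaussian θ σ) s a * heaviside (M.advantage (μ.gaussian θ σ) s a)) •
    Matrix.vecMul (μ.act θ s - a).ofLp (μ.jacobian θ s)

variable {M} in
/-- The CAC direction `Δ_CAC(s, μ_θ) = ∫ π(a|s) A^π(s, a) H(A^π(s, a)) (μ_θ(s) - a) ∇_θ μ_θ(s) da`,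
`π = π_{θ,σ}`; it is a direction of descent. -/
def ParamPolicy.cac (μ : M.ParamPolicy n) (θ : EuclideanSpace ℝ (Fin n)) (σ : ℝ) (s : M.S) :
    Fin n → ℝ :=
  ∫ a, μ.cacIntegrand θ σ s a ∂(μ.gaussian θ σ s)

end MDP

end

/-! Substituting `a = μ_θ(s) + σ z` with `z` standard Gaussian turns the normalized ascent direction
into the expectation of `max (A/σ) 0 • zJ`, where `A` is the advantage of the exploration policy at
`a` and `J` the Jacobian (`cac_eq`). If `A/σ` tends to `⟨b, z⟩`, with `b` the action gradient of the
deterministic advantage, dominated convergence gives the limit `E[max ⟨b, z⟩ 0 • z] J`. By the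
symmetry of the Gaussian this is half of `E[⟨b, z⟩ z] J = bJ`, so `g⁺` can be taken constantly equal
to `1/2`.

The difficulty is that `A` itself depends on `σ` through the policy. By the Bellman equation
(`Q_eq`) the policy enters `Q` only through `∫ T V`, so `Q` is Lipschitz in the action uniformly
over policies (`exists_lipschitz_Q`). A contraction argument then bounds the gap between the values
of the two policies by `O(σ)`, uniformly in the state. Moving the action by `σ z` changes the
integral of this gap against `T` by only `O(σ²)`, hence the difference quotients of `Q` converge to
the deterministic derivative (`tendsto_Q_gaussian_quotient`). Subtracting `V` subtracts their
Gaussian mean, which vanishes in the limit because a linear form has mean zero. -/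

noncomputable section

namespace MDP

variable {d m n : ℕ} (M : MDP d m)

/-! ### Discounted returns and the Bellman equation -/

section Bellman

variable (π : Kernel M.S (EuclideanSpace ℝ (Fin m)))

/-- Expected reward `t` steps ahead, as a function of the current state-action pair. -/
def expReward : ℕ → M.S × EuclideanSpace ℝ (Fin m) → ℝ
  | 0 => fun x => M.R x.1 x.2
  | t + 1 => fun x => ∫ y, expReward t y ∂(M.step π x)

lemma stronglyMeasurable_expReward (t : ℕ) : StronglyMeasurable (M.expReward π t) := by
  induction t with
  | zero => exact M.measurable_R.stronglyMeasurable
  | succ t ih => exact ih.integral_kernel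

variable [IsMarkovKernel π]

instance isProbabilityMeasure_law (ρ : Measure (M.S × EuclideanSpace ℝ (Fin m)))
    [IsProbabilityMeasure ρ] : IsProbabilityMeasure (M.law π ρ) := by
  unfold law; infer_instance

lemma map_law_zero (ρ : Measure (M.S × EuclideanSpace ℝ (Fin m))) [IsProbabilityMeasure ρ] :
    (M.law π ρ).map (fun ω => ω 0) = ρ := by
  have hf : (fun ω : ℕ → M.S × EuclideanSpace ℝ (Fin m) => ω 0) =
      (fun h : (_ : Finset.Iic 0) → M.S × EuclideanSpace ℝ (Fin m) =>
        h ⟨0, Finset.mem_Iic.2 le_rfl⟩) ∘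
        Preorder.frestrictLe (π := fun _ => M.S × EuclideanSpace ℝ (Fin m)) 0 := rfl
  rw [hf, ← Measure.map_map (by fun_prop) (by fun_prop), law, Kernel.trajMeasure,
    Measure.map_comp _ _ (by fun_prop), Kernel.traj_map_frestrictLe, Kernel.partialTraj_self,
    Measure.id_comp, Measure.map_map (by fun_prop) (by fun_prop)]
  exact Measure.map_id

/-- The history kernel reads only the last coordinate, so the one-time marginals evolve as a Markov
chain. -/
lemma map_law_succ (ρ : Measure (M.S × EuclideanSpace ℝ (Fin m))) [IsProbabilityMeasure ρ]
    (t : ℕ) :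
    (M.law π ρ).map (fun ω => ω (t + 1)) = ((M.law π ρ).map (fun ω => ω t)).bind (M.step π) := by
  have h := Kernel.map_frestrictLe_trajMeasure_compProd_eq_map_trajMeasure
    (X := fun _ => M.S × EuclideanSpace ℝ (Fin m)) (μ₀ := ρ) (κ := M.historyStep π) (a := t)
  have h2 := congrArg (fun ν => Measure.map Prod.snd ν) h
  rw [Measure.map_map (by fun_prop) (by fun_prop)] at h2
  change _ = (M.law π ρ).map (fun ω => ω (t + 1)) at h2
  rw [← h2, ← Measure.snd, Measure.snd_compProd]
  change ((M.law π ρ).map _).bind _ = _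
  ext B hB
  rw [Measure.bind_apply hB (by fun_prop), Measure.bind_apply hB (by fun_prop),
    lintegral_map (Kernel.measurable_coe _ hB) (by fun_prop),
    lintegral_map (Kernel.measurable_coe _ hB) (measurable_pi_apply t)]
  rfl

variable {C : ℝ}

lemma abs_expReward_le (hC : ∀ s a, |M.R s a| ≤ C) (t : ℕ) (x) : |M.expReward π t x| ≤ C := by
  induction t generalizing x with
  | zero => exact hC _ _
  | succ t ih =>
    have := norm_integral_le_of_norm_le_const (μ := M.step π x)
      (ae_of_all _ fun y => (Real.norm_eq_abs _).trans_le (ih y))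
    simpa [expReward] using this

lemma integral_bind_step {f : M.S × EuclideanSpace ℝ (Fin m) → ℝ} (hf : StronglyMeasurable f)
    (hC : ∀ x, |f x| ≤ C) (ν : Measure (M.S × EuclideanSpace ℝ (Fin m)))
    [IsProbabilityMeasure ν] :
    ∫ x, f x ∂(ν.bind (M.step π)) = ∫ x, ∫ y, f y ∂(M.step π x) ∂ν := by
  rw [← Measure.snd_compProd, Measure.snd, integral_map (by fun_prop) hf.aestronglyMeasurable,
    Measure.integral_compProd]
  exact Integrable.of_bound (hf.comp_measurable measurable_snd).aestronglyMeasurable C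
    (ae_of_all _ fun x => hC x.2)

/-- Markov property: time steps of the trajectory are traded for iterations of the kernel on
functions. The free `k` lets the induction on `t` go through; only `k = 0` is needed later. -/
lemma integral_law_expReward (hC : ∀ s a, |M.R s a| ≤ C)
    (ρ : Measure (M.S × EuclideanSpace ℝ (Fin m))) [IsProbabilityMeasure ρ] (t k : ℕ) :
    ∫ ω, M.expReward π k (ω t) ∂(M.law π ρ) = ∫ x, M.expReward π (k + t) x ∂ρ := by
  induction t generalizing k with
  | zero =>
    conv_rhs => rw [← M.map_law_zero π ρ]
    rw [integral_map (measurable_pi_apply _).aemeasurable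
        (M.stronglyMeasurable_expReward π _).aestronglyMeasurable]
    rfl
  | succ t ih =>
    have h (t : ℕ) (k : ℕ) : ∫ ω, M.expReward π k (ω t) ∂(M.law π ρ) =
        ∫ x, M.expReward π k x ∂((M.law π ρ).map (fun ω => ω t)) := by
      rw [integral_map (measurable_pi_apply _).aemeasurable
        (M.stronglyMeasurable_expReward π _).aestronglyMeasurable]
    have : IsProbabilityMeasure ((M.law π ρ).map (fun ω => ω t)) :=
      Measure.isProbabilityMeasure_map (measurable_pi_apply _).aemeasurable
    rw [h, map_law_succ, M.integral_bind_step π (M.stronglyMeasurable_expReward π k)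
      (M.abs_expReward_le π hC k), ← add_assoc, add_right_comm, ← ih (k + 1), h]
    rfl

lemma abs_pow_mul_le {x : ℝ} (hx : |x| ≤ C) (t : ℕ) : ‖M.γ ^ t * x‖ ≤ M.γ ^ t * C := by
  rw [norm_mul, Real.norm_of_nonneg (pow_nonneg M.γ_nonneg t)]
  exact mul_le_mul_of_nonneg_left hx (pow_nonneg M.γ_nonneg t)

lemma summable_pow_mul_const : Summable fun t : ℕ => M.γ ^ t * C :=
  (summable_geometric_of_lt_one M.γ_nonneg M.γ_lt_one).mul_right C

/-- Sums of discounted bounded measurable functions commute with integration. -/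
lemma integral_tsum_pow_mul {Ω : Type*} [MeasurableSpace Ω] (ν : Measure Ω)
    [IsProbabilityMeasure ν] {f : ℕ → Ω → ℝ} (hf : ∀ t, StronglyMeasurable (f t))
    (hC : ∀ t x, |f t x| ≤ C) :
    ∫ x, ∑' t, M.γ ^ t * f t x ∂ν = ∑' t, M.γ ^ t * ∫ x, f t x ∂ν := by
  have hb (t : ℕ) : ∀ᵐ x ∂ν, ‖M.γ ^ t * f t x‖ ≤ M.γ ^ t * C :=
    ae_of_all _ fun x => M.abs_pow_mul_le (hC t x) t
  have hi (t : ℕ) : Integrable (fun x => M.γ ^ t * f t x) ν :=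
    Integrable.of_bound ((hf t).const_mul _).aestronglyMeasurable _ (hb t)
  rw [← integral_tsum_of_summable_integral_norm hi]
  · simp_rw [integral_const_mul]
  · refine Summable.of_nonneg_of_le (fun t => by positivity) (fun t => ?_)
      (M.summable_pow_mul_const (C := C))
    calc ∫ x, ‖M.γ ^ t * f t x‖ ∂ν ≤ ∫ _, M.γ ^ t * C ∂ν :=
          integral_mono_ae (hi t).norm (integrable_const _) (hb t)
      _ = M.γ ^ t * C := by simp

lemma integral_discountedReturn (hC : ∀ s a, |M.R s a| ≤ C)
    (ρ : Measure (M.S × EuclideanSpace ℝ (Fin m))) [IsProbabilityMeasure ρ] :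
    ∫ ω, M.discountedReturn ω ∂(M.law π ρ) = ∑' t, M.γ ^ t * ∫ x, M.expReward π t x ∂ρ := by
  have h := M.integral_tsum_pow_mul (M.law π ρ) (f := fun t ω => M.R (ω t).1 (ω t).2)
    (fun t => (M.measurable_R.comp (measurable_pi_apply t)).stronglyMeasurable)
    (fun t ω => hC _ _)
  refine h.trans (tsum_congr fun t => ?_)
  have := M.integral_law_expReward π hC ρ t 0
  rw [zero_add] at this
  rw [← this]
  rfl

lemma Q_eq_tsum (hC : ∀ s a, |M.R s a| ≤ C) (s : M.S) (a : EuclideanSpace ℝ (Fin m)) :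
    M.Q π s a = ∑' t, M.γ ^ t * M.expReward π t (s, a) := by
  rw [Q, M.integral_discountedReturn π hC]
  refine tsum_congr fun t => ?_
  rw [integral_dirac' _ _ (M.stronglyMeasurable_expReward π t)]

lemma stronglyMeasurable_Q (hC : ∀ s a, |M.R s a| ≤ C) :
    StronglyMeasurable fun x : M.S × EuclideanSpace ℝ (Fin m) => M.Q π x.1 x.2 := by
  simp_rw [M.Q_eq_tsum π hC]
  exact (Measurable.tsum fun t =>
    (M.stronglyMeasurable_expReward π t).measurable.const_mul _).stronglyMeasurable

lemma stronglyMeasurable_Q_apply (hC : ∀ s a, |M.R s a| ≤ C) (s : M.S) :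
    StronglyMeasurable (M.Q π s) := by
  have h : M.Q π s = (fun x : M.S × EuclideanSpace ℝ (Fin m) => M.Q π x.1 x.2) ∘ Prod.mk s := rfl
  rw [h]
  exact (M.stronglyMeasurable_Q π hC).comp_measurable measurable_prodMk_left

lemma abs_Q_le (hC : ∀ s a, |M.R s a| ≤ C) (s : M.S) (a : EuclideanSpace ℝ (Fin m)) :
    |M.Q π s a| ≤ C / (1 - M.γ) := by
  rw [M.Q_eq_tsum π hC, ← Real.norm_eq_abs]
  refine tsum_of_norm_bounded ?_ fun t => M.abs_pow_mul_le (M.abs_expReward_le π hC t _) t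
  rw [div_eq_inv_mul]
  exact (hasSum_geometric_of_lt_one M.γ_nonneg M.γ_lt_one).mul_right C

lemma V_eq_integral_Q (hC : ∀ s a, |M.R s a| ≤ C) (s : M.S) :
    M.V π s = ∫ a, M.Q π s a ∂(π s) := by
  have h (t : ℕ) : ∫ x, M.expReward π t x ∂((Measure.dirac s).prod (π s)) =
      ∫ a, M.expReward π t (s, a) ∂(π s) := by
    rw [Measure.dirac_prod, integral_map (by fun_prop)
      (M.stronglyMeasurable_expReward π t).aestronglyMeasurable]
  simp_rw [V, M.integral_discountedReturn π hC, h, M.Q_eq_tsum π hC]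
  exact (M.integral_tsum_pow_mul (π s) (f := fun t a => M.expReward π t (s, a))
    (fun t => (M.stronglyMeasurable_expReward π t).comp_measurable measurable_prodMk_left)
    (fun t a => M.abs_expReward_le π hC t _)).symm

lemma stronglyMeasurable_V (hC : ∀ s a, |M.R s a| ≤ C) : StronglyMeasurable (M.V π) := by
  have : M.V π = fun s => ∫ a, M.Q π s a ∂(π s) := funext (M.V_eq_integral_Q π hC)
  rw [this]
  exact (M.stronglyMeasurable_Q π hC).integral_kernel_prod_right

lemma abs_V_le (hC : ∀ s a, |M.R s a| ≤ C) (s : M.S) : |M.V π s| ≤ C / (1 - M.γ) := by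
  rw [M.V_eq_integral_Q π hC]
  simpa using norm_integral_le_of_norm_le_const (μ := π s)
    (ae_of_all _ fun a => (Real.norm_eq_abs _).trans_le (M.abs_Q_le π hC s a))

lemma integral_transition (x : M.S × EuclideanSpace ℝ (Fin m)) (f : M.S → ℝ) :
    ∫ s', f s' ∂(M.transition x) = ∫ s', M.T x.1 x.2 s' * f s' ∂(stateVolume M.S) := by
  have h : Measurable (Function.uncurry
      fun (x : M.S × EuclideanSpace ℝ (Fin m)) (s' : M.S) =>
        ENNReal.ofReal (M.T x.1 x.2 s')) := M.measurable_T.ennreal_ofReal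
  rw [transition, Kernel.withDensity_apply _ h, Kernel.const_apply,
    integral_withDensity_eq_integral_toReal_smul
      (show Measurable fun s' => ENNReal.ofReal (M.T x.1 x.2 s') from
        h.comp measurable_prodMk_left) (ae_of_all _ fun _ => ENNReal.ofReal_lt_top)]
  refine integral_congr_ae (ae_of_all _ fun s' => ?_)
  simp [ENNReal.toReal_ofReal (M.T_nonneg _ _ _)]

/-- The Bellman equation. -/
lemma Q_eq (hC : ∀ s a, |M.R s a| ≤ C) (s : M.S) (a : EuclideanSpace ℝ (Fin m)) :
    M.Q π s a = M.R s a + M.γ * ∫ s', M.T s a s' * M.V π s' ∂(stateVolume M.S) := by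
  have hs : Summable fun t => M.γ ^ t * M.expReward π t (s, a) :=
    Summable.of_norm_bounded (M.summable_pow_mul_const (C := C))
      fun t => M.abs_pow_mul_le (M.abs_expReward_le π hC t _) t
  have hQ : ∫ y, M.Q π y.1 y.2 ∂(M.step π (s, a)) =
      ∑' t, M.γ ^ t * M.expReward π (t + 1) (s, a) := by
    simp_rw [M.Q_eq_tsum π hC]
    exact M.integral_tsum_pow_mul (M.step π (s, a)) (M.stronglyMeasurable_expReward π)
      (M.abs_expReward_le π hC)
  -- Disintegrating the step, the inner average of `Q` over the next action is `V`.
  have hV : ∫ y, M.Q π y.1 y.2 ∂(M.step π (s, a)) = ∫ s', M.V π s' ∂(M.transition (s, a)) := by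
    rw [step, integral_compProd]
    · simp_rw [M.V_eq_integral_Q π hC]
      rfl
    · exact Integrable.of_bound (M.stronglyMeasurable_Q π hC).aestronglyMeasurable _
        (ae_of_all _ fun y => M.abs_Q_le π hC y.1 y.2)
  rw [M.Q_eq_tsum π hC, hs.tsum_eq_zero_add, ← M.integral_transition (s, a), ← hV, hQ,
    ← tsum_mul_left]
  simp [expReward, pow_succ', mul_assoc]

end Bellman

end MDP

/-! ### Moments of the standard Gaussian -/

section StdGaussian

variable {m : ℕ}

open scoped MatrixOrder in
lemma multivariateGaussian_smul_one (v : EuclideanSpace ℝ (Fin m)) {σ : ℝ} (hσ : 0 ≤ σ) :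
    multivariateGaussian v (σ ^ 2 • (1 : Matrix (Fin m) (Fin m) ℝ)) =
      (stdGaussian (EuclideanSpace ℝ (Fin m))).map fun z => v + σ • z := by
  have h : CFC.sqrt (σ ^ 2 • (1 : Matrix (Fin m) (Fin m) ℝ)) = σ • 1 := by
    refine CFC.sqrt_unique ?_ ?_
    · rw [smul_mul_smul_comm, one_mul, pow_two]
    · exact (Matrix.PosSemidef.one.smul hσ).nonneg
  rw [multivariateGaussian, h]
  congr 1
  ext z : 1
  rw [map_smul, map_one]
  rfl

variable {E : Type*} [NormedAddCommGroup E] [InnerProductSpace ℝ E] [FiniteDimensional ℝ E]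
  [MeasurableSpace E] [BorelSpace E]

lemma integrable_norm_stdGaussian : Integrable (fun z => ‖z‖) (stdGaussian E) :=
  (IsGaussian.integrable_id (μ := stdGaussian E)).norm

lemma integrable_norm_sq_stdGaussian : Integrable (fun z => ‖z‖ ^ 2) (stdGaussian E) :=
  (memLp_two_iff_integrable_sq_norm (by fun_prop)).1
    (IsGaussian.memLp_two_id (μ := stdGaussian E))

lemma integrable_smul_self_stdGaussian {c : E → ℝ} (hc : Measurable c) {L : ℝ}
    (hL : ∀ z, |c z| ≤ L * ‖z‖) : Integrable (fun z => c z • z) (stdGaussian E) := by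
  refine (integrable_norm_sq_stdGaussian.const_mul L).mono' (by fun_prop) (ae_of_all _ fun z => ?_)
  rw [norm_smul, pow_two, ← mul_assoc]
  exact mul_le_mul_of_nonneg_right (hL z) (norm_nonneg z)

lemma integral_comp_neg_stdGaussian {F : Type*} [NormedAddCommGroup F] [NormedSpace ℝ F]
    (f : E → F) : ∫ z, f (-z) ∂(stdGaussian E) = ∫ z, f z ∂(stdGaussian E) := by
  conv_rhs => rw [← stdGaussian_map (LinearIsometryEquiv.neg ℝ (E := E))]
  exact ((LinearIsometryEquiv.neg ℝ (E := E)).toHomeomorph.measurableEmbedding.integral_map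
    f).symm

/-- The covariance is the identity; this is its vector form, obtained by testing against every `y`.
-/
lemma integral_inner_smul_self_stdGaussian (b : E) :
    ∫ z, inner ℝ b z • z ∂(stdGaussian E) = b := by
  have hi : Integrable (fun z => inner ℝ b z • z) (stdGaussian E) :=
    integrable_smul_self_stdGaussian (by fun_prop) fun z => abs_real_inner_le_norm b z
  refine ext_inner_left ℝ fun y => ?_
  rw [← integral_inner hi y]
  have h := covarianceBilin_apply_eq_cov (IsGaussian.memLp_two_id (μ := stdGaussian E)) y b
  have h0 (v : E) : ∫ z, inner ℝ v z ∂(stdGaussian E) = 0 :=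
    integral_strongDual_stdGaussian (innerSL ℝ v)
  rw [covarianceBilin_stdGaussian, covariance, h0, h0] at h
  simp only [sub_zero] at h
  rw [innerSL_apply_apply] at h
  rw [h]
  refine integral_congr_ae (ae_of_all _ fun z => ?_)
  simp [real_inner_smul_right, mul_comm]

/-- The positive half of a linear form carries half of its correlation with the identity. -/
lemma integral_max_inner_smul_self_stdGaussian (b : E) :
    ∫ z, max (inner ℝ b z) 0 • z ∂(stdGaussian E) = (1 / 2 : ℝ) • b := by
  have hb (z : E) := abs_real_inner_le_norm b z
  have hp : Integrable (fun z => max (inner ℝ b z) 0 • z) (stdGaussian E) :=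
    integrable_smul_self_stdGaussian (by fun_prop) fun z => by
      rw [abs_of_nonneg (le_max_right _ _)]
      exact max_le ((le_abs_self _).trans (hb z)) (by positivity)
  have hn : Integrable (fun z => max (-inner ℝ b z) 0 • z) (stdGaussian E) :=
    integrable_smul_self_stdGaussian (by fun_prop) fun z => by
      rw [abs_of_nonneg (le_max_right _ _)]
      exact max_le ((neg_le_abs _).trans (hb z)) (by positivity)
  -- Reflection `z ↦ -z` exchanges the positive and negative parts and reverses the vector factor.
  have hneg : ∫ z, max (-inner ℝ b z) 0 • z ∂(stdGaussian E) =
      -∫ z, max (inner ℝ b z) 0 • z ∂(stdGaussian E) := by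
    rw [← integral_comp_neg_stdGaussian fun z => max (inner ℝ b z) 0 • z, ← integral_neg]
    simp
  have hsub : ∫ z, max (inner ℝ b z) 0 • z ∂(stdGaussian E) -
      ∫ z, max (-inner ℝ b z) 0 • z ∂(stdGaussian E) = b := by
    rw [← integral_sub hp hn]
    conv_rhs => rw [← integral_inner_smul_self_stdGaussian b]
    refine integral_congr_ae (ae_of_all _ fun z => ?_)
    dsimp only
    rw [← sub_smul, max_zero_sub_max_neg_zero_eq_self]
  rw [hneg, sub_neg_eq_add, ← two_smul ℝ] at hsub
  nth_rewrite 2 [← hsub]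
  rw [smul_smul]
  norm_num

end StdGaussian

/-! ### Regularity of `Q` in the action, for an arbitrary policy -/

namespace MDP

variable {d m n : ℕ} (M : MDP d m)

lemma isFiniteMeasure_stateVolume (hS : volume M.S < ⊤) : IsFiniteMeasure (stateVolume M.S) := by
  refine ⟨?_⟩
  rw [stateVolume, comap_subtype_coe_apply M.measurableSet_S]
  simpa using hS

variable {M}

lemma integrable_T_mul {W : M.S → ℝ} (hW : StronglyMeasurable W) {B : ℝ} (hB : ∀ s, |W s| ≤ B)
    (s : M.S) (a : EuclideanSpace ℝ (Fin m)) :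
    Integrable (fun s' => M.T s a s' * W s') (stateVolume M.S) := by
  have hm : Measurable fun s' => M.T s a s' :=
    M.measurable_T.comp (measurable_prodMk_left (x := (s, a)))
  have hT : Integrable (fun s' => M.T s a s') (stateVolume M.S) := by
    refine ⟨hm.aestronglyMeasurable, ?_⟩
    rw [hasFiniteIntegral_iff_ofReal (ae_of_all _ fun s' => M.T_nonneg s a s'), M.lintegral_T]
    exact ENNReal.one_lt_top
  exact hT.mul_bdd hW.aestronglyMeasurable (ae_of_all _ hB)

lemma abs_integral_T_mul_le {W : M.S → ℝ} {B : ℝ} (hB : ∀ s, |W s| ≤ B) (s : M.S)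
    (a : EuclideanSpace ℝ (Fin m)) :
    |∫ s', M.T s a s' * W s' ∂(stateVolume M.S)| ≤ B := by
  rw [← M.integral_transition (s, a) W]
  simpa using norm_integral_le_of_norm_le_const (μ := M.transition (s, a)) (f := W) (ae_of_all _ hB)

namespace Regular

lemma exists_lipschitz_R (hM : M.Regular) :
    ∃ K, 0 ≤ K ∧ ∀ s a b, |M.R s a - M.R s b| ≤ K * ‖a - b‖ := by
  obtain ⟨K, hK⟩ := hM.bounded_grad_R
  refine ⟨max K 0, le_max_right _ _, fun s a b => ?_⟩
  refine Convex.norm_image_sub_le_of_norm_fderiv_le (𝕜 := ℝ) (s := Set.univ)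
    (fun x _ => hM.differentiable_R s x) (fun x _ => ?_) convex_univ trivial trivial
  have := hK s x
  rw [gradient, LinearIsometryEquiv.norm_map] at this
  exact this.trans (le_max_left _ _)

lemma exists_norm_fderiv_T_le (hM : M.Regular) :
    ∃ K, 0 ≤ K ∧ ∀ s a s', ‖fderiv ℝ (fun a => M.T s a s') a‖ ≤ K := by
  obtain ⟨K, hK⟩ := hM.bounded_grad_T
  refine ⟨max K 0, le_max_right _ _, fun s a s' => ?_⟩
  have := hK s a s'
  rw [gradient, LinearIsometryEquiv.norm_map] at this
  exact this.trans (le_max_left _ _)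

lemma exists_lipschitz_T (hM : M.Regular) :
    ∃ K, 0 ≤ K ∧ ∀ s a b s', |M.T s a s' - M.T s b s'| ≤ K * ‖a - b‖ := by
  obtain ⟨K, hK0, hK⟩ := hM.exists_norm_fderiv_T_le
  refine ⟨K, hK0, fun s a b s' => ?_⟩
  exact Convex.norm_image_sub_le_of_norm_fderiv_le (𝕜 := ℝ) (s := Set.univ)
    (fun x _ => hM.differentiable_T s s' x) (fun x _ => hK s x s') convex_univ trivial trivial

/-- The expectation of a bounded function of the next state is Lipschitz in the action. -/
lemma exists_lipschitz_integral_T (hM : M.Regular) (hS : volume M.S < ⊤) :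
    ∃ K, 0 ≤ K ∧ ∀ (W : M.S → ℝ) (B : ℝ), StronglyMeasurable W → (∀ s, |W s| ≤ B) → ∀ s a b,
      |∫ s', M.T s a s' * W s' ∂(stateVolume M.S) - ∫ s', M.T s b s' * W s' ∂(stateVolume M.S)| ≤
        K * B * ‖a - b‖ := by
  have := M.isFiniteMeasure_stateVolume hS
  obtain ⟨K, hK0, hK⟩ := hM.exists_lipschitz_T
  refine ⟨K * (stateVolume M.S).real Set.univ, by positivity, fun W B hW hB s a b => ?_⟩
  rw [← integral_sub (integrable_T_mul hW hB s a) (integrable_T_mul hW hB s b)]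
  have h (s' : M.S) : ‖M.T s a s' * W s' - M.T s b s' * W s'‖ ≤ K * ‖a - b‖ * B := by
    rw [← sub_mul, norm_mul]
    exact mul_le_mul (hK s a b s') (hB s') (norm_nonneg _) (by positivity)
  exact (norm_integral_le_of_norm_le_const (ae_of_all _ h)).trans_eq (by ring)

/-- `L` precedes `π`: the policy enters the Bellman equation only through `V`, which is bounded
independently of `π`. -/
lemma exists_lipschitz_Q (hM : M.Regular) (hS : volume M.S < ⊤) :
    ∃ L, 0 ≤ L ∧ ∀ (π : Kernel M.S (EuclideanSpace ℝ (Fin m))) [IsMarkovKernel π] (s a b),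
      |M.Q π s a - M.Q π s b| ≤ L * ‖a - b‖ := by
  obtain ⟨C, hC⟩ := hM.bounded_R
  obtain ⟨K, hK0, hK⟩ := hM.exists_lipschitz_R
  obtain ⟨K', hK0', hK'⟩ := hM.exists_lipschitz_integral_T hS
  have hγ := sub_pos.2 M.γ_lt_one
  have hγ0 := M.γ_nonneg
  -- `|C|` rather than `C`, whose sign is not given, keeps the constant nonnegative.
  refine ⟨K + M.γ * (K' * (|C| / (1 - M.γ))), by positivity, fun π _ s a b => ?_⟩
  have h := hK' (M.V π) (|C| / (1 - M.γ)) (M.stronglyMeasurable_V π hC)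
    (M.abs_V_le π fun s a => (hC s a).trans (le_abs_self C)) s a b
  rw [M.Q_eq π hC, M.Q_eq π hC, add_sub_add_comm, ← mul_sub, add_mul, mul_assoc M.γ]
  refine (abs_add_le _ _).trans (add_le_add (hK s a b) ?_)
  rw [abs_mul, abs_of_nonneg M.γ_nonneg]
  exact mul_le_mul_of_nonneg_left h M.γ_nonneg

/-- Differentiation under the Bellman integral; on a state space of finite volume a constant
dominates the derivatives. -/
lemma differentiableAt_Q (hM : M.Regular) (hS : volume M.S < ⊤)
    (π : Kernel M.S (EuclideanSpace ℝ (Fin m))) [IsMarkovKernel π] (s : M.S)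
    (a : EuclideanSpace ℝ (Fin m)) : DifferentiableAt ℝ (M.Q π s) a := by
  have := M.isFiniteMeasure_stateVolume hS
  obtain ⟨C, hC⟩ := hM.bounded_R
  obtain ⟨K, hK0, hK⟩ := hM.exists_norm_fderiv_T_le
  have hQ : M.Q π s = fun a =>
      M.R s a + M.γ * ∫ s', M.T s a s' * M.V π s' ∂(stateVolume M.S) :=
    funext fun a => M.Q_eq π hC s a
  rw [hQ]
  refine (hM.differentiable_R s a).add (DifferentiableAt.const_mul ?_ _)
  have hV := M.stronglyMeasurable_V π hC
  have hVb := M.abs_V_le π hC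
  -- Continuity in `s'` serves only the measurability of the differentiated integrand.
  have hcont : Continuous fun s' => fderiv ℝ (fun a => M.T s a s') a := by
    have h1 : Continuous fun s' => gradient (fun a => M.T s a s') a :=
      hM.continuous_grad_T.comp (by fun_prop : Continuous fun s' : M.S => (s, a, s'))
    have h2 := (InnerProductSpace.toDual ℝ (EuclideanSpace ℝ (Fin m))).continuous.comp h1
    simpa [gradient, Function.comp_def] using h2
  refine (hasFDerivAt_integral_of_dominated_of_fderiv_le (𝕜 := ℝ) (s := Set.univ)
    (F := fun a s' => M.T s a s' * M.V π s')
    (F' := fun a s' => M.V π s' • fderiv ℝ (fun a => M.T s a s') a)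
    (bound := fun _ => C / (1 - M.γ) * K) univ_mem
    (Eventually.of_forall fun a => (integrable_T_mul hV hVb s a).aestronglyMeasurable)
    (integrable_T_mul hV hVb s a) ?_ ?_ (integrable_const _) ?_).differentiableAt
  · exact hV.aestronglyMeasurable.smul hcont.aestronglyMeasurable
  · refine ae_of_all _ fun s' x _ => ?_
    rw [norm_smul]
    exact mul_le_mul (hVb s') (hK s x s') (norm_nonneg _) ((abs_nonneg _).trans (hVb s'))
  · exact ae_of_all _ fun s' x _ =>
      (hM.differentiable_T s s' x).hasFDerivAt.mul_const (M.V π s')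

lemma hasFDerivAt_advantage (hM : M.Regular) (hS : volume M.S < ⊤)
    (π : Kernel M.S (EuclideanSpace ℝ (Fin m))) [IsMarkovKernel π] (s : M.S)
    (a : EuclideanSpace ℝ (Fin m)) :
    HasFDerivAt (M.advantage π s) (fderiv ℝ (M.Q π s) a) a :=
  (hM.differentiableAt_Q hS π s a).hasFDerivAt.sub_const _

end Regular

end MDP

/-! ### Exploration policies as `σ → 0` -/

namespace MDP

variable {d m n : ℕ} {M : MDP d m}

namespace ParamPolicy

variable (μ : M.ParamPolicy n) (θ : EuclideanSpace ℝ (Fin n))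

lemma gaussian_apply {σ : ℝ} (hσ : 0 ≤ σ) (s : M.S) :
    μ.gaussian θ σ s =
      (stdGaussian (EuclideanSpace ℝ (Fin m))).map fun z => μ.act θ s + σ • z :=
  multivariateGaussian_smul_one _ hσ

lemma integral_gaussian {F : Type*} [NormedAddCommGroup F] [NormedSpace ℝ F] {σ : ℝ} (hσ : 0 ≤ σ)
    (s : M.S) {f : EuclideanSpace ℝ (Fin m) → F} (hf : StronglyMeasurable f) :
    ∫ a, f a ∂(μ.gaussian θ σ s) =
      ∫ z, f (μ.act θ s + σ • z) ∂(stdGaussian (EuclideanSpace ℝ (Fin m))) := by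
  rw [μ.gaussian_apply θ hσ, integral_map (by fun_prop) hf.aestronglyMeasurable]

variable {C : ℝ}

lemma V_gaussian (hC : ∀ s a, |M.R s a| ≤ C) {σ : ℝ} (hσ : 0 ≤ σ) (s : M.S) :
    M.V (μ.gaussian θ σ) s = ∫ z, M.Q (μ.gaussian θ σ) s (μ.act θ s + σ • z)
      ∂(stdGaussian (EuclideanSpace ℝ (Fin m))) := by
  rw [M.V_eq_integral_Q _ hC,
    μ.integral_gaussian θ hσ s (M.stronglyMeasurable_Q_apply (μ.gaussian θ σ) hC s)]

lemma V_det (hC : ∀ s a, |M.R s a| ≤ C) (s : M.S) :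
    M.V (μ.det θ) s = M.Q (μ.det θ) s (μ.act θ s) := by
  rw [M.V_eq_integral_Q _ hC]
  exact integral_dirac' _ _ (M.stronglyMeasurable_Q_apply (μ.det θ) hC s)

lemma integrable_Q_gaussian (hC : ∀ s a, |M.R s a| ≤ C) (σ : ℝ) (s : M.S) :
    Integrable (fun z => M.Q (μ.gaussian θ σ) s (μ.act θ s + σ • z))
      (stdGaussian (EuclideanSpace ℝ (Fin m))) :=
  Integrable.of_bound ((M.stronglyMeasurable_Q_apply (μ.gaussian θ σ) hC s).comp_measurable
    (by fun_prop : Measurable fun z => μ.act θ s + σ • z)).aestronglyMeasurable _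
    (ae_of_all _ fun _ => M.abs_Q_le _ hC _ _)

/-- The value functions of the exploration policies converge uniformly to that of the
deterministic policy, at rate `σ`. -/
lemma exists_abs_V_gaussian_sub_V_det_le (hM : M.Regular) (hS : volume M.S < ⊤) :
    ∃ K, ∀ σ, 0 ≤ σ → ∀ s, |M.V (μ.gaussian θ σ) s - M.V (μ.det θ) s| ≤ K * σ := by
  obtain ⟨C, hC⟩ := hM.bounded_R
  obtain ⟨L, hL0, hL⟩ := hM.exists_lipschitz_Q hS
  have hγ := sub_pos.2 M.γ_lt_one
  set G := stdGaussian (EuclideanSpace ℝ (Fin m))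
  refine ⟨L * (∫ z, ‖z‖ ∂G) / (1 - M.γ), fun σ hσ s₀ => ?_⟩
  -- The aim is `D ≤ O(σ) + γ D`, which is then solved for `D`; finiteness of the supremum is
  -- essential.
  set D := ⨆ s, |M.V (μ.gaussian θ σ) s - M.V (μ.det θ) s|
  have hbdd : BddAbove (Set.range fun s => |M.V (μ.gaussian θ σ) s - M.V (μ.det θ) s|) := by
    refine ⟨C / (1 - M.γ) + C / (1 - M.γ), ?_⟩
    rintro _ ⟨s, rfl⟩
    exact (abs_sub _ _).trans (add_le_add (M.abs_V_le _ hC s) (M.abs_V_le _ hC s))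
  have hD (s) : |M.V (μ.gaussian θ σ) s - M.V (μ.det θ) s| ≤ D := le_ciSup hbdd s
  have hV (s) : |M.V (μ.gaussian θ σ) s - M.Q (μ.gaussian θ σ) s (μ.act θ s)| ≤
      L * (∫ z, ‖z‖ ∂G) * σ := by
    have hi := μ.integrable_Q_gaussian θ hC σ s
    have hc : M.Q (μ.gaussian θ σ) s (μ.act θ s) =
        ∫ _, M.Q (μ.gaussian θ σ) s (μ.act θ s) ∂G := by simp
    rw [μ.V_gaussian θ hC hσ, hc, ← integral_sub hi (integrable_const _)]
    have hb (z) : ‖M.Q (μ.gaussian θ σ) s (μ.act θ s + σ • z) -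
        M.Q (μ.gaussian θ σ) s (μ.act θ s)‖ ≤ L * σ * ‖z‖ := by
      refine (hL (μ.gaussian θ σ) s _ _).trans_eq ?_
      rw [add_sub_cancel_left, norm_smul, Real.norm_of_nonneg hσ, mul_assoc]
    refine (norm_integral_le_of_norm_le (integrable_norm_stdGaussian.const_mul (L * σ))
      (ae_of_all _ hb)).trans_eq ?_
    rw [integral_const_mul]
    ring
  -- At a common action the rewards cancel, leaving `γ` times a probability average of the value
  -- gap.
  have hQ (s) : |M.Q (μ.gaussian θ σ) s (μ.act θ s) - M.Q (μ.det θ) s (μ.act θ s)| ≤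
      M.γ * D := by
    rw [M.Q_eq _ hC, M.Q_eq _ hC, add_sub_add_left_eq_sub, ← mul_sub, abs_mul,
      abs_of_nonneg M.γ_nonneg,
      ← integral_sub (integrable_T_mul (M.stronglyMeasurable_V _ hC) (M.abs_V_le _ hC) _ _)
        (integrable_T_mul (M.stronglyMeasurable_V _ hC) (M.abs_V_le _ hC) _ _)]
    simp_rw [← mul_sub]
    exact mul_le_mul_of_nonneg_left (abs_integral_T_mul_le hD s _) M.γ_nonneg
  have : Nonempty M.S := ⟨s₀⟩
  have hle : D ≤ L * (∫ z, ‖z‖ ∂G) * σ + M.γ * D := by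
    refine ciSup_le fun s => ?_
    rw [μ.V_det θ hC]
    exact (abs_sub_le _ (M.Q (μ.gaussian θ σ) s (μ.act θ s)) _).trans (add_le_add (hV s) (hQ s))
  refine (hD s₀).trans ?_
  rw [div_mul_eq_mul_div, le_div_iff₀ hγ]
  linarith

/-- The difference quotients of `Q` under the exploration policies converge to the derivative of
`Q` under the deterministic policy. -/
lemma tendsto_Q_gaussian_quotient (hM : M.Regular) (hS : volume M.S < ⊤) (s : M.S)
    (a z : EuclideanSpace ℝ (Fin m)) :
    Tendsto (fun σ : ℝ => σ⁻¹ * (M.Q (μ.gaussian θ σ) s (a + σ • z) - M.Q (μ.gaussian θ σ) s a))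
      (𝓝[>] 0) (𝓝 (fderiv ℝ (M.Q (μ.det θ) s) a z)) := by
  obtain ⟨C, hC⟩ := hM.bounded_R
  obtain ⟨K, hK0, hK⟩ := hM.exists_lipschitz_integral_T hS
  obtain ⟨K', hK'⟩ := μ.exists_abs_V_gaussian_sub_V_det_le θ hM hS
  have h0 : Tendsto (fun σ : ℝ => σ⁻¹ * (M.Q (μ.det θ) s (a + σ • z) - M.Q (μ.det θ) s a))
      (𝓝[>] 0) (𝓝 (fderiv ℝ (M.Q (μ.det θ) s) a z)) := by
    have h := (hM.differentiableAt_Q hS (μ.det θ) s a).hasFDerivAt.hasLineDerivAt z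
    exact h.tendsto_slope_zero_right
  -- The value gap is `O(σ)` and the displacement is `σ‖z‖`: their product, divided by `σ`, is still
  -- `O(σ)`.
  have hdiff (σ : ℝ) (hσ : 0 < σ) :
      |σ⁻¹ * (M.Q (μ.gaussian θ σ) s (a + σ • z) - M.Q (μ.gaussian θ σ) s a) -
        σ⁻¹ * (M.Q (μ.det θ) s (a + σ • z) - M.Q (μ.det θ) s a)| ≤
        M.γ * (K * (K' * σ) * ‖z‖) := by
    have hI (π : Kernel M.S (EuclideanSpace ℝ (Fin m))) [IsMarkovKernel π] (b) :
        Integrable (fun s' => M.T s b s' * M.V π s') (stateVolume M.S) :=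
      integrable_T_mul (M.stronglyMeasurable_V _ hC) (M.abs_V_le _ hC) s b
    have hW : StronglyMeasurable fun s => M.V (μ.gaussian θ σ) s - M.V (μ.det θ) s :=
      (M.stronglyMeasurable_V _ hC).sub (M.stronglyMeasurable_V _ hC)
    have h := hK _ _ hW (hK' σ hσ.le) s (a + σ • z) a
    simp_rw [mul_sub] at h
    rw [integral_sub (hI _ _) (hI _ _), integral_sub (hI _ _) (hI _ _), add_sub_cancel_left,
      norm_smul, Real.norm_of_nonneg hσ.le] at h
    simp_rw [M.Q_eq _ hC]
    calc _ = σ⁻¹ * (M.γ * |_|) := by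
          rw [← abs_of_nonneg M.γ_nonneg, ← abs_mul, ← abs_of_pos (inv_pos.2 hσ), ← abs_mul,
            abs_of_nonneg M.γ_nonneg, abs_of_pos (inv_pos.2 hσ)]
          congr 1
          ring
      _ ≤ σ⁻¹ * (M.γ * (K * (K' * σ) * (σ * ‖z‖))) :=
          mul_le_mul_of_nonneg_left (mul_le_mul_of_nonneg_left h M.γ_nonneg) (inv_nonneg.2 hσ.le)
      _ = M.γ * (K * (K' * σ) * ‖z‖) := by field_simp
  have hz : Tendsto (fun σ : ℝ => M.γ * (K * (K' * σ) * ‖z‖)) (𝓝[>] 0) (𝓝 0) := by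
    have : Continuous fun σ : ℝ => M.γ * (K * (K' * σ) * ‖z‖) := by fun_prop
    simpa using (this.tendsto 0).mono_left nhdsWithin_le_nhds
  have := (squeeze_zero_norm' (eventually_nhdsWithin_of_forall hdiff) hz).add h0
  simpa using this

end ParamPolicy

end MDP

/-! ### The CAC direction and its limit -/

namespace MDP

variable {d m n : ℕ} {M : MDP d m}

lemma mul_heaviside (x : ℝ) : x * heaviside x = max x 0 := by
  unfold heaviside
  split_ifs with h
  · rw [mul_one, max_eq_left h.le]
  · rw [mul_zero, max_eq_right (not_lt.1 h)]

/-- Multiplication of row vectors by a matrix, as a continuous linear map. -/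
def vecMulCLM (J : Matrix (Fin m) (Fin n) ℝ) : EuclideanSpace ℝ (Fin m) →L[ℝ] (Fin n → ℝ) :=
  LinearMap.toContinuousLinearMap
    (J.vecMulLinear ∘ₗ (WithLp.linearEquiv 2 ℝ (Fin m → ℝ)).toLinearMap)

lemma vecMulCLM_apply (J : Matrix (Fin m) (Fin n) ℝ) (x : EuclideanSpace ℝ (Fin m)) :
    vecMulCLM J x = Matrix.vecMul x.ofLp J := rfl

namespace ParamPolicy

variable (μ : M.ParamPolicy n) (θ : EuclideanSpace ℝ (Fin n))

lemma cacIntegrand_eq (σ : ℝ) (s : M.S) (a : EuclideanSpace ℝ (Fin m)) :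
    μ.cacIntegrand θ σ s a = max (M.advantage (μ.gaussian θ σ) s a) 0 •
      vecMulCLM (μ.jacobian θ s) (μ.act θ s - a) := by
  rw [cacIntegrand, mul_heaviside, vecMulCLM_apply]

variable {C : ℝ}

lemma stronglyMeasurable_advantage_gaussian (hC : ∀ s a, |M.R s a| ≤ C) (σ : ℝ) (s : M.S) :
    StronglyMeasurable (M.advantage (μ.gaussian θ σ) s) :=
  (M.stronglyMeasurable_Q_apply (μ.gaussian θ σ) hC s).sub stronglyMeasurable_const

lemma stronglyMeasurable_cacIntegrand (hC : ∀ s a, |M.R s a| ≤ C) (σ : ℝ) (s : M.S) :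
    StronglyMeasurable (μ.cacIntegrand θ σ s) := by
  have h : μ.cacIntegrand θ σ s = fun a => max (M.advantage (μ.gaussian θ σ) s a) 0 •
      vecMulCLM (μ.jacobian θ s) (μ.act θ s - a) := funext (μ.cacIntegrand_eq θ σ s)
  rw [h]
  have h1 := (μ.stronglyMeasurable_advantage_gaussian θ hC σ s).measurable
  exact Measurable.stronglyMeasurable (by fun_prop)

lemma integrable_cacIntegrand (hC : ∀ s a, |M.R s a| ≤ C) (σ : ℝ) (s : M.S) :
    Integrable (μ.cacIntegrand θ σ s) (μ.gaussian θ σ s) := by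
  have hG : Integrable (fun a => vecMulCLM (μ.jacobian θ s) (μ.act θ s - a))
      (μ.gaussian θ σ s) := by
    refine ContinuousLinearMap.integrable_comp _ ((integrable_const _).sub ?_)
    change Integrable id (multivariateGaussian (μ.act θ s)
      (σ ^ 2 • (1 : Matrix (Fin m) (Fin m) ℝ)))
    exact IsGaussian.integrable_id
  have hA := (μ.stronglyMeasurable_advantage_gaussian θ hC σ s).measurable
  refine (hG.bdd_smul (φ := fun a => max (M.advantage (μ.gaussian θ σ) s a) 0)
    (C / (1 - M.γ) + C / (1 - M.γ)) ?_ ?_).congr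
    (ae_of_all _ fun a => (μ.cacIntegrand_eq θ σ s a).symm)
  · exact (hA.max measurable_const).aestronglyMeasurable
  · refine ae_of_all _ fun a => ?_
    have h : |M.advantage (μ.gaussian θ σ) s a| ≤ C / (1 - M.γ) + C / (1 - M.γ) :=
      (abs_sub _ _).trans (add_le_add (M.abs_Q_le _ hC s a) (M.abs_V_le _ hC s))
    rw [Real.norm_of_nonneg (le_max_right _ _)]
    exact max_le ((le_abs_self _).trans h) ((abs_nonneg _).trans h)

/-- Under `a = μ_θ(s) + σ z`, the factor `μ_θ(s) - a = -σ z` absorbs the sign and one `σ⁻¹`; the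
other `σ⁻¹` is positive and passes inside the positive part. -/
lemma cac_eq (hC : ∀ s a, |M.R s a| ≤ C) {σ : ℝ} (hσ : 0 < σ) (s : M.S) :
    -(1 / σ ^ 2) • μ.cac θ σ s =
      ∫ z, max (σ⁻¹ * M.advantage (μ.gaussian θ σ) s (μ.act θ s + σ • z)) 0 •
        vecMulCLM (μ.jacobian θ s) z ∂(stdGaussian (EuclideanSpace ℝ (Fin m))) := by
  rw [cac, μ.integral_gaussian θ hσ.le s (μ.stronglyMeasurable_cacIntegrand θ hC σ s),
    ← integral_smul]
  refine integral_congr_ae (ae_of_all _ fun z => ?_)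
  dsimp only
  have h : max (σ⁻¹ * M.advantage (μ.gaussian θ σ) s (μ.act θ s + σ • z)) 0 =
      σ⁻¹ * max (M.advantage (μ.gaussian θ σ) s (μ.act θ s + σ • z)) 0 := by
    rw [mul_max_of_nonneg _ _ (inv_nonneg.2 hσ.le), mul_zero]
  rw [cacIntegrand_eq, sub_add_cancel_left, map_neg, map_smul, h, ← neg_smul, smul_smul, smul_smul]
  congr 1
  field_simp

/-- The rescaled advantage along a Gaussian perturbation is asymptotically linear, with a linear
bound that is uniform in `σ`. -/
lemma exists_advantage_gaussian_bound_and_tendsto (hM : M.Regular) (hS : volume M.S < ⊤)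
    (s : M.S) :
    ∃ L, 0 ≤ L ∧
      (∀ σ, 0 < σ → ∀ z, |σ⁻¹ * M.advantage (μ.gaussian θ σ) s (μ.act θ s + σ • z)| ≤
        L * ‖z‖ + L) ∧
      ∀ z, Tendsto (fun σ : ℝ => σ⁻¹ * M.advantage (μ.gaussian θ σ) s (μ.act θ s + σ • z))
        (𝓝[>] 0) (𝓝 (inner ℝ (gradient (M.advantage (μ.det θ) s) (μ.act θ s)) z)) := by
  obtain ⟨C, hC⟩ := hM.bounded_R
  obtain ⟨L, hL0, hL⟩ := hM.exists_lipschitz_Q hS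
  set G := stdGaussian (EuclideanSpace ℝ (Fin m))
  let q (σ : ℝ) (z : EuclideanSpace ℝ (Fin m)) : ℝ :=
    σ⁻¹ * (M.Q (μ.gaussian θ σ) s (μ.act θ s + σ • z) - M.Q (μ.gaussian θ σ) s (μ.act θ s))
  have hqb (σ : ℝ) (hσ : 0 < σ) (z) : ‖q σ z‖ ≤ L * ‖z‖ := by
    have h := hL (μ.gaussian θ σ) s (μ.act θ s + σ • z) (μ.act θ s)
    rw [add_sub_cancel_left, norm_smul, Real.norm_of_nonneg hσ.le] at h
    simp only [q, norm_mul, norm_inv, Real.norm_of_nonneg hσ.le]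
    rw [inv_mul_le_iff₀ hσ]
    exact h.trans_eq (by ring)
  have hqi (σ : ℝ) : Integrable (q σ) G :=
    ((μ.integrable_Q_gaussian θ hC σ s).sub (integrable_const _)).const_mul _
  have hdom : Integrable (fun z => L * ‖z‖) G := integrable_norm_stdGaussian.const_mul L
  -- Since `V` is the Gaussian mean of `Q`, the rescaled advantage is the difference quotient minus
  -- its own mean.
  have hadv (σ : ℝ) (hσ : 0 < σ) (z) :
      σ⁻¹ * M.advantage (μ.gaussian θ σ) s (μ.act θ s + σ • z) = q σ z - ∫ z', q σ z' ∂G := by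
    have h : ∫ z', q σ z' ∂G =
        σ⁻¹ * (M.V (μ.gaussian θ σ) s - M.Q (μ.gaussian θ σ) s (μ.act θ s)) := by
      rw [integral_const_mul, integral_sub (μ.integrable_Q_gaussian θ hC σ s)
        (integrable_const _), ← μ.V_gaussian θ hC hσ.le]
      simp
    rw [h, advantage]
    ring
  have hlim (z) := μ.tendsto_Q_gaussian_quotient θ hM hS s (μ.act θ s) z
  have hint : Tendsto (fun σ => ∫ z, q σ z ∂G) (𝓝[>] 0) (𝓝 0) := by
    have h0 := integral_strongDual_stdGaussian (fderiv ℝ (M.Q (μ.det θ) s) (μ.act θ s))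
    conv_rhs => rw [← h0]
    exact tendsto_integral_filter_of_dominated_convergence _
      (Eventually.of_forall fun σ => (hqi σ).aestronglyMeasurable)
      (eventually_nhdsWithin_of_forall fun σ hσ => ae_of_all _ (hqb σ hσ)) hdom
      (ae_of_all _ hlim)
  have hE0 : 0 ≤ ∫ z, ‖z‖ ∂G := integral_nonneg fun _ => norm_nonneg _
  -- One constant serves as slope, for `q`, and as intercept, for its mean.
  refine ⟨L * (1 + ∫ z, ‖z‖ ∂G), by positivity, fun σ hσ z => ?_, fun z => ?_⟩
  · rw [hadv σ hσ]
    have h1 : ‖∫ z', q σ z' ∂G‖ ≤ L * ∫ z, ‖z‖ ∂G :=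
      (norm_integral_le_of_norm_le hdom (ae_of_all _ (hqb σ hσ))).trans_eq (integral_const_mul _ _)
    have h2 := norm_sub_le (q σ z) (∫ z', q σ z' ∂G)
    have h3 := hqb σ hσ z
    have h4 : 0 ≤ L * (∫ z, ‖z‖ ∂G) * ‖z‖ := by positivity
    rw [Real.norm_eq_abs] at h2
    linarith
  · have h := (hlim z).sub hint
    rw [sub_zero] at h
    have hg : inner ℝ (gradient (M.advantage (μ.det θ) s) (μ.act θ s)) z =
        fderiv ℝ (M.Q (μ.det θ) s) (μ.act θ s) z := by
      rw [gradient, InnerProductSpace.toDual_symm_apply,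
        (hM.hasFDerivAt_advantage hS (μ.det θ) s _).fderiv]
    rw [hg]
    exact h.congr' (eventually_nhdsWithin_of_forall fun σ hσ => (hadv σ hσ z).symm)

lemma tendsto_cac (hM : M.Regular) (hS : volume M.S < ⊤) (s : M.S) :
    Tendsto (fun σ : ℝ => -(1 / σ ^ 2) • μ.cac θ σ s) (𝓝[>] 0)
      (𝓝 ((1 / 2 : ℝ) • μ.dpg θ s)) := by
  obtain ⟨C, hC⟩ := hM.bounded_R
  obtain ⟨L, hL0, hL, hlim⟩ := μ.exists_advantage_gaussian_bound_and_tendsto θ hM hS s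
  set G := stdGaussian (EuclideanSpace ℝ (Fin m))
  set Λ := vecMulCLM (μ.jacobian θ s)
  set b := gradient (M.advantage (μ.det θ) s) (μ.act θ s)
  have hval : ∫ z, max (inner ℝ b z) 0 • Λ z ∂G = (1 / 2 : ℝ) • μ.dpg θ s := by
    have hp : Integrable (fun z => max (inner ℝ b z) 0 • z) G :=
      integrable_smul_self_stdGaussian (by fun_prop) (L := ‖b‖) fun z => by
        rw [abs_of_nonneg (le_max_right _ _)]
        exact max_le ((le_abs_self _).trans (abs_real_inner_le_norm b z)) (by positivity)
    simp_rw [← map_smul]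
    rw [Λ.integral_comp_comm hp, integral_max_inner_smul_self_stdGaussian, map_smul]
    rfl
  rw [← hval]
  refine Tendsto.congr' (eventually_nhdsWithin_of_forall fun σ hσ => (μ.cac_eq θ hC hσ s).symm) ?_
  -- The linear bound on the advantage times `‖z‖` is quadratic, so two Gaussian moments suffice.
  refine tendsto_integral_filter_of_dominated_convergence
    (fun z => L * ‖Λ‖ * ‖z‖ ^ 2 + L * ‖Λ‖ * ‖z‖) ?_ ?_ ?_ ?_
  · refine Eventually.of_forall fun σ => Measurable.aestronglyMeasurable ?_
    have h := (μ.stronglyMeasurable_advantage_gaussian θ hC σ s).measurable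
    fun_prop
  · refine eventually_nhdsWithin_of_forall fun σ hσ => ae_of_all _ fun z => ?_
    rw [norm_smul, Real.norm_of_nonneg (le_max_right _ _)]
    calc _ ≤ (L * ‖z‖ + L) * (‖Λ‖ * ‖z‖) :=
          mul_le_mul (max_le ((le_abs_self _).trans (hL σ hσ z)) (by positivity))
            (Λ.le_opNorm z) (norm_nonneg _) (by positivity)
      _ = _ := by ring
  · exact (integrable_norm_sq_stdGaussian.const_mul _).add
      (integrable_norm_stdGaussian.const_mul _)
  · exact ae_of_all _ fun z => ((hlim z).max tendsto_const_nhds).smul_const _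

end ParamPolicy

end MDP

end

theorem mainTheorem1 {d m n : ℕ} (M : MDP d m) (hM : M.Regular) (hS : volume M.S < ⊤)
    (μ : M.ParamPolicy n) (hμ : μ.Regular) (θ : EuclideanSpace ℝ (Fin n)) (s : M.S) :
    DifferentiableAt ℝ (M.advantage (μ.det θ) s) (μ.act θ s) ∧
    (∀ σ : ℝ, 0 < σ → Integrable (μ.cacIntegrand θ σ s) (μ.gaussian θ σ s)) ∧
    ∃ g : Fin n → ℝ, (∀ k, 0 < g k ∧ g k ≤ 1) ∧
      Tendsto (fun σ : ℝ => -(1 / σ ^ 2) • μ.cac θ σ s) (𝓝[>] 0) (𝓝 (g * μ.dpg θ s)) := by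
  obtain ⟨C, hC⟩ := hM.bounded_R
  -- The witness `1 / 2` is the Gaussian weight of the half-space where the linearized advantage is
  -- positive.
  refine ⟨(hM.hasFDerivAt_advantage hS (μ.det θ) s _).differentiableAt,
    fun σ _ => μ.integrable_cacIntegrand θ hC σ s, fun _ => 1 / 2, fun _ => by norm_num, ?_⟩
  exact μ.tendsto_cac θ hM hS s
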